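/- **Setting.** Let $N\ge 2$ be an integer, and let $x_0<x_1<\dots<x_N$ and $y_0<y_1<\dots<y_N$ be equally spaced points with $x_N-x_0=y_N-y_0$. Put $I=[x_0,x_N]$, $J=[y_0,y_N]$ and $D=I\times J$, and let $z_{ij}\in\mathbb{R}$ for $0\le i,j\le N$. For $1\le i\le N$ let $u_i:I\to[x_{i-1},x_i]$ be the affine bijection that is increasing if $i$ is odd and decreasing if $i$ is even; define $v_j:J\to[y_{j-1},y_j]$ in the same way. Let $\Sigma=\{1,\dots,N\}^2$, and for $w=(i,j)\in\Sigma$ put $L_w(x,y)=(u_i(x),v_j(y))$ and $D_w=L_w(D)$. Let $g,h,S:D\to\mathbb{R}$ be continuous with $g(x_i,y_j)=z_{ij}$ for $i,j\in\{0,N\}$, $h(x_i,y_j)=z_{ij}$ for $0\le i,j\le N$, and $|S|<1$ on $D$. Let $q:D\to\mathbb{R}$ be the function given by $q=h-S\cdot(g\circ L_w^{-1})$ on $D_w$ for each $w\in\Sigma$. Assume that $S$ and $q$ are Lipschitz on $D$. For $w=(i,j)\in\Sigma$ let $$\Psi_w(x,y,z)=\Big(u_i(x),\,v_j(y),\,S(L_w(x,y))\,\big(z-g(x,y)\big)+h(L_w(x,y))\Big).$$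 Let $f:D\to\mathbb{R}$ be the generalized affine fractal interpolation function of these data, that is, the continuous function with $f(x_i,y_j)=z_{ij}$ for all $0\le i,j\le N$ whose graph $\Gamma f=\{(x,y,f(x,y)):(x,y)\in D\}$ satisfies $\Gamma f=\bigcup_{w\in\Sigma}\Psi_w(\Gamma f)$. For a word $\mathbf{w}=w_1\cdots w_n\in\Sigma^n$ let $D_{\mathbf{w}}=L_{w_1}\circ\cdots\circ L_{w_n}(D)$ and $\overline{s}_{\mathbf{w}}=\sup_{D_{\mathbf{w}}}|S|$. For $n\ge1$ let $\overline{M}_n$ be the upper vertical scaling matrix of level $n$, that is, the $\Sigma^n\times\Sigma^n$ matrix whose entry at $(\mathbf{i},\mathbf{j})$, where $\mathbf{i}=i_1\cdots i_n$ and $\mathbf{j}=j_1\cdots j_n$, is $\overline{s}_{i_1\cdots i_n j_n}$ if $i_2\cdots i_n=j_1\cdots j_{n-1}$, and $0$ otherwise. Let $\rho(A)$ denote the spectral radius of a matrix $A$. For a bounded set $E\subset\mathbb{R}^3$ let $\mathcal{N}_E(\varepsilon)$ be the number of cubes $\prod_{k=1}^3[n_k\varepsilon,(n_k+1)\varepsilon]$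 with $n_k\in\mathbb{Z}$ that meet $E$, and let $\overline{\dim}_B E=\limsup_{\varepsilon\to0^+}\log\mathcal{N}_E(\varepsilon)/\log(1/\varepsilon)$ be its upper box dimension. **Theorem.** Assume that there is no subrectangle of $D$ (with nonempty interior) on which $S$ is identically zero. Then the limit $\rho^*=\lim_{n\to\infty}\rho(\overline{M}_n)$ exists in $\mathbb{R}$, and $$\overline{\dim}_B\,\Gamma f\le\max\Big\{2,\ 1+\frac{\log\rho^*}{\log N}\Big\},$$ where the maximum is read as $2$ if $\rho^*=0$. -/

import Mathlib

open Filter Topology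

/-! ### Box dimension -/

/-- The closed `ε`-coordinate cube `∏ i, [n i * ε, (n i + 1) * ε]` in `ℝ^d`. -/
def coordCube {d : ℕ} (ε : ℝ) (n : Fin d → ℤ) : Set (Fin d → ℝ) :=
  {p | ∀ i, (n i : ℝ) * ε ≤ p i ∧ p i ≤ ((n i : ℝ) + 1) * ε}

/-- The number of `ε`-coordinate cubes that meet the (bounded) set `E`. -/
noncomputable def boxCount {d : ℕ} (E : Set (Fin d → ℝ)) (ε : ℝ) : ℕ :=
  Set.ncard {n : Fin d → ℤ | (coordCube ε n ∩ E).Nonempty}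

/-- The upper box dimension of a bounded set `E` in `ℝ^d`. The upper limit is taken in the
extended reals, so that it needs no side condition. -/
noncomputable def upperBoxDim {d : ℕ} (E : Set (Fin d → ℝ)) : EReal :=
  limsup (fun ε : ℝ => ((Real.log (boxCount E ε) / Real.log (1 / ε) : ℝ) : EReal)) (𝓝[>] 0)

/-! ### Spectral radius -/

/-- The spectral radius of a real square matrix: the largest modulus of a complex eigenvalue. -/
noncomputable def matrixSpectralRadius {ι : Type*} [Fintype ι] [DecidableEq ι]
    (A : Matrix ι ι ℝ) : ℝ :=
  (spectralRadius ℂ (A.map (algebraMap ℝ ℂ))).toReal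

/-! ### Generalized affine fractal interpolation surfaces -/

/-- The digit set `{1, …, N} × {1, …, N}`; the element `i : Fin N` stands for the digit `i + 1`. -/
abbrev Digit (N : ℕ) : Type := Fin N × Fin N

/-- The words of length `n` over the digit set. -/
abbrev Word (N n : ℕ) : Type := Fin n → Digit N

/-- The data of a surface over an `N × N` grid: the grid points `x 0, …, x N` and `y 0, …, y N`,
the interpolation values `z i j`, and the functions `g`, `h`, `S`. Only the values of
`g`, `h`, `S` on the domain rectangle matter. -/
structure FISData (N : ℕ) where
  x : Fin (N + 1) → ℝ
  y : Fin (N + 1) → ℝ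
  z : Fin (N + 1) → Fin (N + 1) → ℝ
  g : ℝ × ℝ → ℝ
  h : ℝ × ℝ → ℝ
  S : ℝ × ℝ → ℝ

/-- For `i : Fin N`, standing for the subinterval `[t i, t (i + 1)]`, the affine map that sends
`t 0, t N` to `t i, t (i + 1)` if `i` is even, and to `t (i + 1), t i` if `i` is odd.
(In the numbering `1, …, N` of the subintervals, even and odd change places.) -/
noncomputable def foldMap {N : ℕ} (t : Fin (N + 1) → ℝ) (i : Fin N) (s : ℝ) : ℝ :=
  if Even (i : ℕ) then
    AffineMap.lineMap (t i.castSucc) (t i.succ) ((s - t 0) / (t (Fin.last N) - t 0))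
  else
    AffineMap.lineMap (t i.succ) (t i.castSucc) ((s - t 0) / (t (Fin.last N) - t 0))

namespace FISData

variable {N : ℕ} (d : FISData N)

/-- The domain `D = [x 0, x N] × [y 0, y N]`. -/
def D : Set (ℝ × ℝ) :=
  Set.Icc (d.x 0) (d.x (Fin.last N)) ×ˢ Set.Icc (d.y 0) (d.y (Fin.last N))

/-- The map `L_w (x, y) = (u_i x, v_j y)` for the digit `w = (i, j)`. -/
noncomputable def L (w : Digit N) (p : ℝ × ℝ) : ℝ × ℝ :=
  (foldMap d.x w.1 p.1, foldMap d.y w.2 p.2)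

/-- `F_w (x, y, z) = S (L_w (x, y)) * (z - g (x, y)) + h (L_w (x, y))`. -/
noncomputable def F (w : Digit N) (p : ℝ × ℝ) (z : ℝ) : ℝ :=
  d.S (d.L w p) * (z - d.g p) + d.h (d.L w p)

/-- `Ψ_w (x, y, z) = (L_w (x, y), F_w (x, y, z))`, as a map of `ℝ^3`. -/
noncomputable def Psi (w : Digit N) (p : Fin 3 → ℝ) : Fin 3 → ℝ :=
  ![(d.L w (p 0, p 1)).1, (d.L w (p 0, p 1)).2, d.F w (p 0, p 1) (p 2)]

/-- The graph over `D` of a function `f`, as a subset of `ℝ^3`. -/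
def graph (f : ℝ × ℝ → ℝ) : Set (Fin 3 → ℝ) :=
  (fun p : ℝ × ℝ => ![p.1, p.2, f p]) '' d.D

/-- `f` is the generalized affine fractal interpolation function of the data: it is continuous
on `D`, it interpolates the values `z i j`, and its graph is invariant under the iterated
function system `{Ψ_w}`. -/
structure IsFIF (f : ℝ × ℝ → ℝ) : Prop where
  continuousOn : ContinuousOn f d.D
  interpolates : ∀ i j, f (d.x i, d.y j) = d.z i j
  invariant : d.graph f = ⋃ w : Digit N, d.Psi w '' d.graph f

/-- `q` is the function on `D` given by `q = h - S * (g ∘ L_w⁻¹)` on every `D_w = L_w (D)`.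
As the `D_w` cover `D`, this determines `q` on `D`. -/
def IsQ (q : ℝ × ℝ → ℝ) : Prop :=
  ∀ w : Digit N, ∀ p ∈ d.D, q (d.L w p) = d.h (d.L w p) - d.S (d.L w p) * d.g p

/-- The standing assumptions: an increasing, equally spaced grid over a square, with at least two
subintervals in each direction; `g` and `h` are continuous and take the prescribed values at the
corners and at all grid points, respectively; `|S| < 1` on `D`; and `S` and `q` are Lipschitz
on `D`. (Being Lipschitz for some constant does not depend on the choice between the Euclidean
metric and the maximum metric of `ℝ × ℝ`.) -/
structure Admissible : Prop where
  two_le : 2 ≤ N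
  x_strictMono : StrictMono d.x
  y_strictMono : StrictMono d.y
  x_spacing : ∀ i : Fin N, d.x i.succ - d.x i.castSucc = (d.x (Fin.last N) - d.x 0) / N
  y_spacing : ∀ j : Fin N, d.y j.succ - d.y j.castSucc = (d.y (Fin.last N) - d.y 0) / N
  square : d.x (Fin.last N) - d.x 0 = d.y (Fin.last N) - d.y 0
  g_continuousOn : ContinuousOn d.g d.D
  g_corner : ∀ i j, (i = 0 ∨ i = Fin.last N) → (j = 0 ∨ j = Fin.last N) →
    d.g (d.x i, d.y j) = d.z i j
  h_continuousOn : ContinuousOn d.h d.D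
  h_grid : ∀ i j, d.h (d.x i, d.y j) = d.z i j
  S_abs_lt_one : ∀ p ∈ d.D, |d.S p| < 1
  S_lipschitz : ∃ K, LipschitzOnWith K d.S d.D
  q_lipschitz : ∃ q, d.IsQ q ∧ ∃ K, LipschitzOnWith K q d.D

/-- `S` is not identically zero on any nondegenerate closed subrectangle of `D`. -/
def NonvanishingOnRectangles : Prop :=
  ∀ a b c e : ℝ, a < b → c < e → Set.Icc a b ×ˢ Set.Icc c e ⊆ d.D →
    ∃ p ∈ Set.Icc a b ×ˢ Set.Icc c e, d.S p ≠ 0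

/-- `L_{w_1 ⋯ w_n} = L_{w_1} ∘ ⋯ ∘ L_{w_n}`; the identity for the empty word. -/
noncomputable def wordMap : {n : ℕ} → Word N n → ℝ × ℝ → ℝ × ℝ
  | 0, _ => id
  | _ + 1, w => d.L (w 0) ∘ wordMap (Fin.tail w)

/-- The cell `D_w = L_w (D)` of a word `w`. -/
def cell {n : ℕ} (w : Word N n) : Set (ℝ × ℝ) := d.wordMap w '' d.D

/-- The supremum of `|S|` over the cell `D_w`. -/
noncomputable def supS {n : ℕ} (w : Word N n) : ℝ := sSup ((fun p => |d.S p|) '' d.cell w)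

/-- The upper vertical scaling matrix of level `n + 1`, indexed by the words of length `n + 1`.
The entry at `(i, j)` is the supremum of `|S|` over the cell of the word `i j_{n+1}` if
`i_2 ⋯ i_{n+1} = j_1 ⋯ j_n`, and `0` otherwise. -/
noncomputable def upperMatrix (n : ℕ) : Matrix (Word N (n + 1)) (Word N (n + 1)) ℝ :=
  fun i j =>
    if Fin.tail i = Fin.init j then
      d.supS (Fin.snoc (α := fun _ => Digit N) i (j (Fin.last n)) : Word N (n + 2))
    else 0

end FISData

/-! On each cell the invariance of the graph reads `f ∘ L_w = (S ∘ L_w) * f + q ∘ L_w`. Since `S`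
and `q` are Lipschitz, the oscillation of `f` on the cell of `i a u` is at most `supS (i a)` times
its oscillation on the cell of `(tail i) a u`, up to `c / N ^ l` with `l` the length of `u`
(`exists_osc_cons_le`). Sum over `a` and `u`: the vector of total oscillations, indexed by the
prefix `i`, satisfies `V (l + 1) ≤ M V l + N ^ 2 * c * N ^ l` with `M` the upper matrix. Hence `V l
= O(r ^ l)` for every `r` above both `N` and the spectral radius of `M`
(`exists_le_mul_pow_of_le_mulVec_add`).

At scale about `N ^ (-l)` the graph over a cell meets `O(osc / ε + 1)` cubes, so `O(N ^ l * r ^ l)`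
cubes cover the graph and its upper box dimension is at most `1 + log r / log N`.

Refining the level shrinks the cells on which the suprema are taken, so the spectral radii decrease
in the level and converge to some `ρ`. Choosing the level after `r`, and then letting `r` decrease
to `max ρ N`, gives the bound. -/

/-! ### Spectral radius and growth of matrix powers (Gelfand's formula) -/

section SpectralRadius

attribute [local instance] Matrix.linftyOpNormedRing Matrix.linftyOpNormedAlgebra

variable {ι : Type*} [Fintype ι] [DecidableEq ι]

theorem norm_entry_le_linfty_opNorm (A : Matrix ι ι ℂ) (i j : ι) : ‖A i j‖ ≤ ‖A‖ := by
  have h1 : ‖A i j‖₊ ≤ ∑ k, ‖A i k‖₊ :=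
    Finset.single_le_sum (f := fun k => ‖A i k‖₊) (fun _ _ => zero_le) (Finset.mem_univ j)
  have h2 : (∑ k, ‖A i k‖₊) ≤ ‖A‖₊ := by
    rw [Matrix.linfty_opNNNorm_def]
    exact Finset.le_sup (f := fun i => ∑ k, ‖A i k‖₊) (Finset.mem_univ i)
  exact_mod_cast h1.trans h2

theorem linfty_opNorm_le_of_entry_le (A : Matrix ι ι ℂ) {c : ℝ} (hc : 0 ≤ c)
    (h : ∀ i j, ‖A i j‖ ≤ c) : ‖A‖ ≤ Fintype.card ι * c := by
  lift c to NNReal using hc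
  have : ‖A‖₊ ≤ Fintype.card ι * c := by
    rw [Matrix.linfty_opNNNorm_def]
    refine Finset.sup_le fun i _ => ?_
    calc ∑ j, ‖A i j‖₊ ≤ ∑ _j : ι, c := Finset.sum_le_sum fun j _ => by exact_mod_cast h i j
      _ = _ := by simp
  exact_mod_cast this

theorem map_ofReal_pow_apply (A : Matrix ι ι ℝ) (n : ℕ) (i j : ι) :
    ‖((A.map (algebraMap ℝ ℂ)) ^ n) i j‖ = |(A ^ n) i j| := by
  rw [← Matrix.map_pow]
  simp

theorem spectralRadius_map_ne_top (A : Matrix ι ι ℝ) :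
    spectralRadius ℂ (A.map (algebraMap ℝ ℂ)) ≠ ⊤ := by
  have h := spectrum.spectralRadius_le_pow_nnnorm_pow_one_div ℂ (A.map (algebraMap ℝ ℂ)) 0
  refine ne_top_of_le_ne_top ?_ h
  simp only [Nat.cast_zero, zero_add, div_one, ENNReal.rpow_one]
  exact ENNReal.mul_ne_top ENNReal.coe_ne_top ENNReal.coe_ne_top

theorem matrixSpectralRadius_nonneg (A : Matrix ι ι ℝ) : 0 ≤ matrixSpectralRadius A :=
  ENNReal.toReal_nonneg

theorem exists_abs_pow_apply_le_of_matrixSpectralRadius_lt (A : Matrix ι ι ℝ) {r : ℝ}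
    (h : matrixSpectralRadius A < r) : ∃ C, 0 < C ∧ ∀ n i j, |(A ^ n) i j| ≤ C * r ^ n := by
  have hr : 0 < r := (matrixSpectralRadius_nonneg A).trans_lt h
  set a := A.map (algebraMap ℝ ℂ) with ha
  have hlt : spectralRadius ℂ a < ENNReal.ofReal r :=
    (ENNReal.lt_ofReal_iff_toReal_lt (spectralRadius_map_ne_top A)).2 h
  have hO : (fun n => ‖a ^ n‖) =O[atTop] fun n => r ^ n := by
    refine Asymptotics.IsBigO.of_bound 1 ?_
    filter_upwards [(spectrum.pow_norm_pow_one_div_tendsto_nhds_spectralRadius a).eventually_lt_const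
      hlt, eventually_gt_atTop 0] with n hn hn0
    have h1 : ‖a ^ n‖ ^ (1 / n : ℝ) < r := (ENNReal.ofReal_lt_ofReal_iff hr).1 hn
    have h2 := pow_le_pow_left₀ (by positivity) h1.le n
    rw [one_div, Real.rpow_inv_natCast_pow (norm_nonneg _) hn0.ne'] at h2
    simpa [abs_of_pos hr] using h2
  obtain ⟨C, hC, hb⟩ := Asymptotics.bound_of_isBigO_nat_atTop hO
  refine ⟨C, hC, fun n i j => ?_⟩
  have := hb (x := n) (pow_pos hr n).ne'
  rw [norm_norm, Real.norm_of_nonneg (pow_pos hr n).le] at this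
  rw [← map_ofReal_pow_apply]
  exact (norm_entry_le_linfty_opNorm _ i j).trans this

theorem matrixSpectralRadius_le_of_abs_pow_apply_le (A : Matrix ι ι ℝ) {C r : ℝ} (hC : 0 ≤ C)
    (hr : 0 ≤ r) (h : ∀ n i j, |(A ^ n) i j| ≤ C * r ^ n) : matrixSpectralRadius A ≤ r := by
  set a := A.map (algebraMap ℝ ℂ) with ha
  -- The summand `1` keeps `K` positive even when `C = 0`, so that `K ^ (1 / n)` tends to `1`.
  set K : ℝ := Fintype.card ι * C + 1 with hK
  have hK0 : 0 < K := by positivity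
  have hb : ∀ n, ‖a ^ n‖ ≤ K * r ^ n := fun n => by
    have h1 := linfty_opNorm_le_of_entry_le (a ^ n) (c := C * r ^ n) (by positivity) fun i j => by
      rw [map_ofReal_pow_apply]; exact h n i j
    have h2 : 0 ≤ r ^ n := by positivity
    rw [hK]; nlinarith
  have hlim : Tendsto (fun n : ℕ => ENNReal.ofReal (K ^ (1 / n : ℝ) * r)) atTop
      (𝓝 (ENNReal.ofReal r)) := by
    refine ENNReal.tendsto_ofReal ?_
    have h1 : Tendsto (fun n : ℕ => K ^ (1 / n : ℝ)) atTop (𝓝 (K ^ (0 : ℝ))) :=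
      (Real.continuousAt_const_rpow hK0.ne').tendsto.comp tendsto_one_div_atTop_nhds_zero_nat
    simpa using h1.mul_const r
  have hle : spectralRadius ℂ a ≤ ENNReal.ofReal r := by
    refine le_of_tendsto_of_tendsto (spectrum.pow_norm_pow_one_div_tendsto_nhds_spectralRadius a)
      hlim ?_
    filter_upwards [eventually_gt_atTop 0] with n hn
    refine ENNReal.ofReal_le_ofReal ?_
    calc ‖a ^ n‖ ^ (1 / n : ℝ) ≤ (K * r ^ n) ^ (1 / n : ℝ) :=
          Real.rpow_le_rpow (norm_nonneg _) (hb n) (by positivity)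
      _ = K ^ (1 / n : ℝ) * r := by
          rw [Real.mul_rpow hK0.le (by positivity), one_div, Real.pow_rpow_inv_natCast hr hn.ne']
  exact ENNReal.toReal_le_of_le_ofReal hr hle

end SpectralRadius

/-! ### Sums over words -/

theorem sum_snoc {α M : Type*} [Fintype α] [AddCommMonoid M] {n : ℕ} (F : (Fin (n + 1) → α) → M) :
    ∑ w, F w = ∑ t : Fin n → α, ∑ a : α, F (Fin.snoc (α := fun _ => α) t a) := by
  rw [← (Fin.snocEquiv fun _ => α).sum_comp, Fintype.sum_prod_type_right]
  rfl

theorem sum_cons {α M : Type*} [Fintype α] [AddCommMonoid M] {n : ℕ} (F : (Fin (n + 1) → α) → M) :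
    ∑ w, F w = ∑ t : Fin n → α, ∑ a : α, F (Fin.cons (α := fun _ => α) a t) := by
  rw [← (Fin.consEquiv fun _ => α).sum_comp, Fintype.sum_prod_type_right]
  rfl

/-! ### Cells, the functional equation, and suprema of `|S|` -/

namespace FISData

variable {N : ℕ} {d : FISData N} {f : ℝ × ℝ → ℝ}

theorem abs_foldMap_sub {t : Fin (N + 1) → ℝ} (ht : t 0 < t (Fin.last N))
    (hs : ∀ i : Fin N, t i.succ - t i.castSucc = (t (Fin.last N) - t 0) / N) (i : Fin N)
    (a b : ℝ) : |foldMap t i a - foldMap t i b| = |a - b| / N := by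
  have h0 : t (Fin.last N) - t 0 ≠ 0 := (sub_pos.2 ht).ne'
  have key : |foldMap t i a - foldMap t i b| =
      |(t i.succ - t i.castSucc) * ((a - b) / (t (Fin.last N) - t 0))| := by
    unfold foldMap
    split_ifs
    · rw [AffineMap.lineMap_apply_ring', AffineMap.lineMap_apply_ring']
      congr 1; field_simp; ring
    · rw [AffineMap.lineMap_apply_ring', AffineMap.lineMap_apply_ring', ← abs_neg]
      congr 1; field_simp; ring
  rw [key, hs, div_mul_div_comm, mul_comm (N : ℝ), mul_div_mul_left _ _ h0, abs_div, Nat.abs_cast]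

theorem Admissible.x_lt (hd : d.Admissible) : d.x 0 < d.x (Fin.last N) :=
  hd.x_strictMono (Fin.lt_def.2 (by have := hd.two_le; simp; omega))

theorem Admissible.y_lt (hd : d.Admissible) : d.y 0 < d.y (Fin.last N) :=
  hd.y_strictMono (Fin.lt_def.2 (by have := hd.two_le; simp; omega))

theorem Admissible.dist_L (hd : d.Admissible) (w : Digit N) (p q : ℝ × ℝ) :
    dist (d.L w p) (d.L w q) = dist p q / N := by
  simp only [L, Prod.dist_eq, Real.dist_eq, abs_foldMap_sub hd.x_lt hd.x_spacing,
    abs_foldMap_sub hd.y_lt hd.y_spacing]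
  rw [max_div_div_right (Nat.cast_nonneg N)]

theorem Admissible.dist_wordMap (hd : d.Admissible) {n : ℕ} (w : Word N n) (p q : ℝ × ℝ) :
    dist (d.wordMap w p) (d.wordMap w q) = dist p q / N ^ n := by
  induction n with
  | zero => simp [wordMap]
  | succ n ih =>
    rw [wordMap, Function.comp_apply, Function.comp_apply, hd.dist_L, ih, pow_succ, div_div]

theorem wordMap_cons {n : ℕ} (a : Digit N) (w : Word N n) :
    d.wordMap (Fin.cons a w : Word N (n + 1)) = d.L a ∘ d.wordMap w := by
  rw [wordMap]; rfl

theorem wordMap_snoc {n : ℕ} (w : Word N n) (a : Digit N) :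
    d.wordMap (Fin.snoc w a : Word N (n + 1)) = d.wordMap w ∘ d.L a := by
  induction n with
  | zero =>
    rw [wordMap, wordMap, wordMap]; rfl
  | succ n ih =>
    rw [← Fin.cons_self_tail w, ← Fin.cons_snoc_eq_snoc_cons]
    rw [wordMap_cons, wordMap_cons, ih]; rfl

theorem isCompact_D : IsCompact d.D := isCompact_Icc.prod isCompact_Icc

theorem Admissible.nonempty_D (hd : d.Admissible) : d.D.Nonempty :=
  ⟨(d.x 0, d.y 0), ⟨Set.left_mem_Icc.2 hd.x_lt.le, Set.left_mem_Icc.2 hd.y_lt.le⟩⟩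

theorem mem_graph {p : Fin 3 → ℝ} : p ∈ d.graph f ↔ (p 0, p 1) ∈ d.D ∧ p 2 = f (p 0, p 1) := by
  constructor
  · rintro ⟨q, hq, rfl⟩
    exact ⟨hq, rfl⟩
  · rintro ⟨h1, h2⟩
    refine ⟨(p 0, p 1), h1, ?_⟩
    ext i
    fin_cases i
    · rfl
    · rfl
    · exact h2.symm

/-- Read off from the inclusion of `Ψ_w (Γf)` in `Γf`; no computation with the grid is needed. The
reverse inclusion similarly shows in `IsFIF.exists_preimage` that the cells cover `D`. -/
theorem IsFIF.maps (hf : d.IsFIF f) (w : Digit N) {p : ℝ × ℝ} (hp : p ∈ d.D) :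
    d.L w p ∈ d.D ∧ f (d.L w p) = d.F w p (f p) := by
  have h : d.Psi w ![p.1, p.2, f p] ∈ d.graph f := by
    rw [hf.invariant]
    exact Set.mem_iUnion.2 ⟨w, Set.mem_image_of_mem _ ⟨p, hp, rfl⟩⟩
  rw [mem_graph] at h
  exact ⟨h.1, h.2.symm⟩

theorem IsFIF.exists_preimage (hf : d.IsFIF f) {p : ℝ × ℝ} (hp : p ∈ d.D) :
    ∃ w, ∃ q ∈ d.D, d.L w q = p := by
  have h : ![p.1, p.2, f p] ∈ d.graph f := ⟨p, hp, rfl⟩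
  rw [hf.invariant] at h
  obtain ⟨w, _, ⟨q, hq, rfl⟩, h⟩ := Set.mem_iUnion.1 h
  exact ⟨w, q, hq, Prod.ext (congrFun h 0) (congrFun h 1)⟩

theorem IsFIF.wordMap_mem (hf : d.IsFIF f) {n : ℕ} (w : Word N n) {p : ℝ × ℝ} (hp : p ∈ d.D) :
    d.wordMap w p ∈ d.D := by
  induction n with
  | zero => simpa [wordMap] using hp
  | succ n ih => rw [wordMap]; exact (hf.maps _ (ih _)).1

theorem IsFIF.cell_subset (hf : d.IsFIF f) {n : ℕ} (w : Word N n) : d.cell w ⊆ d.D := by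
  rintro _ ⟨p, hp, rfl⟩
  exact hf.wordMap_mem w hp

theorem IsFIF.exists_mem_cell (hf : d.IsFIF f) (n : ℕ) {p : ℝ × ℝ} (hp : p ∈ d.D) :
    ∃ w : Word N n, p ∈ d.cell w := by
  induction n generalizing p with
  | zero => exact ⟨Fin.elim0, p, hp, rfl⟩
  | succ n ih =>
    obtain ⟨a, q, hq, rfl⟩ := hf.exists_preimage hp
    obtain ⟨w, s, hs, rfl⟩ := ih hq
    exact ⟨Fin.cons a w, s, hs, by rw [wordMap_cons]; rfl⟩

theorem Admissible.bddAbove_abs_S (hd : d.Admissible) (hf : d.IsFIF f) {n : ℕ} (w : Word N n) :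
    BddAbove ((fun p => |d.S p|) '' d.cell w) := by
  refine ⟨1, ?_⟩
  rintro _ ⟨p, hp, rfl⟩
  exact (hd.S_abs_lt_one p (hf.cell_subset w hp)).le

theorem supS_nonneg {n : ℕ} (w : Word N n) : 0 ≤ d.supS w :=
  Real.sSup_nonneg (by rintro _ ⟨p, _, rfl⟩; exact abs_nonneg _)

theorem Admissible.abs_S_le_supS (hd : d.Admissible) (hf : d.IsFIF f) {n : ℕ} {w : Word N n}
    {p : ℝ × ℝ} (hp : p ∈ d.cell w) : |d.S p| ≤ d.supS w :=
  le_csSup (hd.bddAbove_abs_S hf w) ⟨p, hp, rfl⟩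

theorem Admissible.supS_snoc_le (hd : d.Admissible) (hf : d.IsFIF f) {n : ℕ} (w : Word N n)
    (a : Digit N) : d.supS (Fin.snoc w a : Word N (n + 1)) ≤ d.supS w := by
  refine csSup_le_csSup (hd.bddAbove_abs_S hf w) ((hd.nonempty_D.image _).image _)
    (Set.image_mono ?_)
  rintro _ ⟨p, hp, rfl⟩
  rw [wordMap_snoc]
  exact ⟨_, (hf.maps a hp).1, rfl⟩

/-! ### The scaling matrices -/

theorem upperMatrix_nonneg (n : ℕ) (i j : Word N (n + 1)) : 0 ≤ d.upperMatrix n i j := by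
  unfold upperMatrix
  split_ifs
  · exact supS_nonneg _
  · exact le_rfl

theorem upperMatrix_pow_nonneg (n l : ℕ) (i j : Word N (n + 1)) :
    0 ≤ (d.upperMatrix n ^ l) i j := by
  induction l generalizing j with
  | zero => rw [pow_zero, Matrix.one_apply]; split_ifs <;> norm_num
  | succ l ih =>
    rw [pow_succ, Matrix.mul_apply]
    exact Finset.sum_nonneg fun k _ => mul_nonneg (ih k) (upperMatrix_nonneg n k j)

theorem upperMatrix_mulVec (n : ℕ) (v : Word N (n + 1) → ℝ) (i : Word N (n + 1)) :
    (d.upperMatrix n).mulVec v i = ∑ a : Digit N, d.supS (Fin.snoc i a : Word N (n + 2)) *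
      v (Fin.snoc (Fin.tail i) a : Word N (n + 1)) := by
  rw [Matrix.mulVec, dotProduct, sum_snoc, Finset.sum_eq_single (Fin.tail i)]
  · simp [upperMatrix]
  · intro t _ ht
    simp [upperMatrix, ht.symm]
  · simp

theorem vecMul_upperMatrix (n : ℕ) (v : Word N (n + 1) → ℝ) (j : Word N (n + 1)) :
    Matrix.vecMul v (d.upperMatrix n) j = ∑ a : Digit N,
      v (Fin.cons a (Fin.init j) : Word N (n + 1)) * d.supS (Fin.cons a j : Word N (n + 2)) := by
  rw [Matrix.vecMul, dotProduct, sum_cons, Finset.sum_eq_single (Fin.init j)]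
  · refine Finset.sum_congr rfl fun a _ => ?_
    rw [upperMatrix, if_pos (by simp), ← Fin.cons_snoc_eq_snoc_cons, Fin.snoc_init_self]
  · intro t _ ht
    simp [upperMatrix, ht]
  · simp

/-- Column sums are the right quantity to compare: their recursion prepends a letter, which commutes
with dropping the last letter, and dropping the last letter enlarges the cell and so can only
increase `supS`. -/
theorem Admissible.vecMul_upperMatrix_pow_le (hd : d.Admissible) (hf : d.IsFIF f) (n l : ℕ)
    (j : Word N (n + 2)) :
    Matrix.vecMul 1 (d.upperMatrix (n + 1) ^ l) j ≤
      Matrix.vecMul 1 (d.upperMatrix n ^ l) (Fin.init j) := by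
  induction l generalizing j with
  | zero => simp
  | succ l ih =>
    rw [pow_succ, ← Matrix.vecMul_vecMul, pow_succ, ← Matrix.vecMul_vecMul, vecMul_upperMatrix,
      vecMul_upperMatrix]
    refine Finset.sum_le_sum fun a _ => ?_
    have h1 := ih (Fin.cons a (Fin.init j))
    have h2 : Fin.init (Fin.cons a (Fin.init j) : Word N (n + 2)) =
        (Fin.cons a (Fin.init (Fin.init j)) : Word N (n + 1)) := by
      conv_lhs => rw [← Fin.snoc_init_self (Fin.init j), Fin.cons_snoc_eq_snoc_cons, Fin.init_snoc]
    rw [h2] at h1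
    have h3 : d.supS (Fin.cons a j : Word N (n + 3)) ≤
        d.supS (Fin.cons a (Fin.init j) : Word N (n + 2)) := by
      conv_lhs => rw [← Fin.snoc_init_self j, Fin.cons_snoc_eq_snoc_cons]
      exact hd.supS_snoc_le hf _ _
    refine mul_le_mul h1 h3 (supS_nonneg _) ?_
    exact dotProduct_nonneg_of_nonneg (fun _ => zero_le_one)
      fun i => upperMatrix_pow_nonneg _ _ _ _

/-- An entry of a nonnegative matrix is at most its column sum, so geometric growth of the powers at
level `n` passes to the next level through the comparison of column sums. -/
theorem Admissible.matrixSpectralRadius_upperMatrix_antitone (hd : d.Admissible)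
    (hf : d.IsFIF f) : Antitone fun n => matrixSpectralRadius (d.upperMatrix n) := by
  refine antitone_nat_of_succ_le fun n => le_of_forall_gt_imp_ge_of_dense fun r hr => ?_
  have hr0 := (matrixSpectralRadius_nonneg _).trans_lt hr
  obtain ⟨C, hC, h⟩ := exists_abs_pow_apply_le_of_matrixSpectralRadius_lt _ hr
  refine matrixSpectralRadius_le_of_abs_pow_apply_le _
    (C := Fintype.card (Word N (n + 1)) * C) (by positivity) hr0.le fun l i j => ?_
  rw [abs_of_nonneg (upperMatrix_pow_nonneg _ _ _ _)]
  calc (d.upperMatrix (n + 1) ^ l) i j ≤ ∑ i, (d.upperMatrix (n + 1) ^ l) i j :=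
        Finset.single_le_sum (f := fun i => (d.upperMatrix (n + 1) ^ l) i j)
          (fun i _ => upperMatrix_pow_nonneg _ _ _ _) (Finset.mem_univ i)
    _ = Matrix.vecMul 1 (d.upperMatrix (n + 1) ^ l) j := by simp [Matrix.vecMul, dotProduct]
    _ ≤ Matrix.vecMul 1 (d.upperMatrix n ^ l) (Fin.init j) := hd.vecMul_upperMatrix_pow_le hf n l j
    _ = ∑ i, (d.upperMatrix n ^ l) i (Fin.init j) := by simp [Matrix.vecMul, dotProduct]
    _ ≤ ∑ _i : Word N (n + 1), C * r ^ l :=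
        Finset.sum_le_sum fun i _ => (le_abs_self _).trans (h l i _)
    _ = _ := by rw [Finset.sum_const, nsmul_eq_mul, mul_assoc]; rfl

end FISData

/-! ### A linear recursive inequality -/

theorem abs_mulVec_le {ι : Type*} [Fintype ι] (A : Matrix ι ι ℝ) (v : ι → ℝ) {c : ℝ} {i : ι}
    (h : ∀ j, |A i j| ≤ c) : |A.mulVec v i| ≤ c * ∑ j, |v j| := by
  rw [Matrix.mulVec, dotProduct, Finset.mul_sum]
  refine (Finset.abs_sum_le_sum_abs _ _).trans (Finset.sum_le_sum fun j _ => ?_)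
  rw [abs_mul]
  exact mul_le_mul_of_nonneg_right (h j) (abs_nonneg _)

/-- Solutions of `V (l + 1) ≤ A V l + c b ^ l` grow at most like `r ^ l` whenever `r` exceeds
both the spectral radius of `A` and `b`. -/
theorem exists_le_mul_pow_of_le_mulVec_add {ι : Type*} [Fintype ι] [DecidableEq ι]
    (A : Matrix ι ι ℝ) (hA : ∀ l i j, 0 ≤ (A ^ l) i j) {V : ℕ → ι → ℝ} {b c r : ℝ}
    (hb : 0 ≤ b) (hc : 0 ≤ c) (hV : ∀ l i, V (l + 1) i ≤ A.mulVec (V l) i + c * b ^ l)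
    (hr : matrixSpectralRadius A < r) (hbr : b < r) :
    ∃ K, 0 ≤ K ∧ ∀ l i, V l i ≤ K * r ^ l := by
  have hr0 : 0 < r := (matrixSpectralRadius_nonneg A).trans_lt hr
  obtain ⟨C, hC, hpow⟩ := exists_abs_pow_apply_le_of_matrixSpectralRadius_lt A hr
  set G : ℝ := c * (C * Fintype.card ι) / (r - b) with hG
  have hrb : 0 < r - b := sub_pos.2 hbr
  have hG0 : 0 ≤ G := by positivity
  set E : ℝ := C * (∑ j, |V 0 j|) + G with hE
  have hE0 : 0 ≤ E := by positivity
  -- Carrying an arbitrary power `A ^ m` through the induction lets the constant `C` enter only once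
  -- instead of once per step. The correction `-G * b ^ l` absorbs the inhomogeneous term, as `G *
  -- (r - b) = c * C * card ι`.
  have key : ∀ l m i, (A ^ m).mulVec (V l) i ≤ r ^ m * (E * r ^ l - G * b ^ l) := by
    intro l
    induction l with
    | zero =>
      intro m i
      have := (le_abs_self _).trans (abs_mulVec_le (A ^ m) (V 0) (hpow m i))
      simp only [pow_zero, mul_one, hE, add_sub_cancel_right]
      linarith
    | succ l ih =>
      intro m i
      have h1 : (A ^ m).mulVec (V (l + 1)) i ≤
          (A ^ m).mulVec (A.mulVec (V l) + (c * b ^ l) • (1 : ι → ℝ)) i := by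
        refine dotProduct_le_dotProduct_of_nonneg_left (fun j => ?_) fun j => hA m i j
        simpa using hV l j
      have h2 : (A ^ m).mulVec (1 : ι → ℝ) i ≤ C * r ^ m * Fintype.card ι := by
        simpa using (le_abs_self _).trans (abs_mulVec_le (A ^ m) 1 (hpow m i))
      rw [Matrix.mulVec_add, Matrix.mulVec_mulVec, ← pow_succ, Matrix.mulVec_smul, Pi.add_apply,
        Pi.smul_apply, smul_eq_mul] at h1
      have h3 := ih (m + 1) i
      have h4 : c * b ^ l * (A ^ m).mulVec (1 : ι → ℝ) i ≤
          c * b ^ l * (C * r ^ m * Fintype.card ι) :=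
        mul_le_mul_of_nonneg_left h2 (by positivity)
      have h5 : c * (C * Fintype.card ι) = G * (r - b) := by rw [hG]; field_simp
      have h6 : c * b ^ l * (C * r ^ m * Fintype.card ι) = G * (r - b) * (b ^ l * r ^ m) := by
        rw [← h5]; ring
      calc _ ≤ _ := h1
        _ ≤ r ^ (m + 1) * (E * r ^ l - G * b ^ l) + G * (r - b) * (b ^ l * r ^ m) := by
          rw [← h6]; exact add_le_add h3 h4
        _ = _ := by ring
  refine ⟨E, hE0, fun l i => ?_⟩
  have h := key l 0 i
  rw [pow_zero, Matrix.one_mulVec, pow_zero, one_mul] at h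
  have : 0 ≤ G * b ^ l := by positivity
  linarith

/-! ### Oscillation of `f` over cells -/

namespace FISData

variable {N : ℕ} {d : FISData N} {f : ℝ × ℝ → ℝ}

/-- The oscillation of `f` over the cell of the concatenation of the words `i` and `u`. -/
noncomputable def osc (d : FISData N) (f : ℝ × ℝ → ℝ) {m l : ℕ} (i : Word N m) (u : Word N l) :
    ℝ :=
  Metric.diam (f '' (d.wordMap i '' d.cell u))

theorem IsFIF.abs_sub_le_osc (hf : d.IsFIF f) {m l : ℕ} (i : Word N m) (u : Word N l)
    {p q : ℝ × ℝ} (hp : p ∈ d.wordMap i '' d.cell u) (hq : q ∈ d.wordMap i '' d.cell u) :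
    |f p - f q| ≤ d.osc f i u := by
  rw [← Real.dist_eq]
  refine Metric.dist_le_diam_of_mem ?_ (Set.mem_image_of_mem f hp) (Set.mem_image_of_mem f hq)
  refine (isCompact_D.image_of_continuousOn hf.continuousOn).isBounded.subset (Set.image_mono ?_)
  rintro _ ⟨s, hs, rfl⟩
  exact hf.wordMap_mem i (hf.cell_subset u hs)

theorem Admissible.exists_dist_le (hd : d.Admissible) :
    ∃ A, 0 < A ∧ ∀ {m l : ℕ} (i : Word N m) (u : Word N l), ∀ p ∈ d.wordMap i '' d.cell u,
      ∀ q ∈ d.wordMap i '' d.cell u, dist p q ≤ A / N ^ (m + l) := by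
  refine ⟨Metric.diam d.D + 1, by positivity, ?_⟩
  rintro m l i u _ ⟨_, ⟨p, hp, rfl⟩, rfl⟩ _ ⟨_, ⟨q, hq, rfl⟩, rfl⟩
  rw [hd.dist_wordMap, hd.dist_wordMap, div_div, ← pow_add, add_comm l]
  gcongr
  exact (Metric.dist_le_diam_of_mem isCompact_D.isBounded hp hq).trans (by linarith)

/-- Apply the functional equation at two points of the cell, with `s`, `s'` their preimages under
the first map of `i`. The difference of values splits into `S * (f s - f s')`, bounded by the first
term, and increments of `S` (times the bounded `f`) and of `q`, bounded by Lipschitz constants times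
the cell diameter. -/
theorem Admissible.exists_osc_cons_le (hd : d.Admissible) (hf : d.IsFIF f) :
    ∃ c, 0 ≤ c ∧ ∀ (k l : ℕ) (i : Word N (k + 1)) (a : Digit N) (u : Word N l),
      d.osc f i (Fin.cons a u : Word N (l + 1)) ≤
        d.supS (Fin.snoc i a : Word N (k + 2)) *
          d.osc f (Fin.snoc (Fin.tail i) a : Word N (k + 1)) u + c / N ^ l := by
  obtain ⟨K, hK⟩ := hd.S_lipschitz
  obtain ⟨q, hq, K', hK'⟩ := hd.q_lipschitz
  obtain ⟨B, hB⟩ := isCompact_D.exists_bound_of_continuousOn hf.continuousOn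
  obtain ⟨A, hA, hdist⟩ := hd.exists_dist_le
  have hB0 : 0 ≤ B := (norm_nonneg _).trans (hB _ hd.nonempty_D.some_mem)
  have hN : (1 : ℝ) ≤ N := by have := hd.two_le; exact_mod_cast (by omega : 1 ≤ N)
  refine ⟨(K * B + K') * A, by positivity, fun k l i a u => ?_⟩
  have hmem : ∀ p ∈ d.wordMap i '' d.cell (Fin.cons a u : Word N (l + 1)),
      ∃ s ∈ d.wordMap (Fin.snoc (Fin.tail i) a : Word N (k + 1)) '' d.cell u, s ∈ d.D ∧
        p ∈ d.D ∧ d.L (i 0) s = p ∧ |d.S p| ≤ d.supS (Fin.snoc i a : Word N (k + 2)) := by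
    rintro _ ⟨_, ⟨p, hp, rfl⟩, rfl⟩
    have hp' := hf.wordMap_mem u hp
    have h1 : d.wordMap i (d.wordMap (Fin.cons a u : Word N (l + 1)) p) =
        d.wordMap (Fin.snoc i a : Word N (k + 2)) (d.wordMap u p) := by
      rw [wordMap_cons, wordMap_snoc]; rfl
    rw [h1]
    refine ⟨_, ⟨_, ⟨p, hp, rfl⟩, rfl⟩, hf.wordMap_mem _ hp', hf.wordMap_mem _ hp', ?_,
      hd.abs_S_le_supS hf ⟨_, hp', rfl⟩⟩
    rw [wordMap_snoc, wordMap_snoc]; rfl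
  have hosc : 0 ≤ d.osc f (Fin.snoc (Fin.tail i) a : Word N (k + 1)) u := Metric.diam_nonneg
  have hs0 := supS_nonneg (d := d) (Fin.snoc i a : Word N (k + 2))
  refine Metric.diam_le_of_forall_dist_le (by positivity) ?_
  rintro _ ⟨p, hp, rfl⟩ _ ⟨p', hp', rfl⟩
  have hpp : dist p p' ≤ A / N ^ l := by
    refine (hdist _ _ p hp p' hp').trans ?_
    gcongr
    omega
  obtain ⟨s, hs, hsD, hpD, rfl, hS⟩ := hmem p hp
  obtain ⟨s', hs', hsD', hpD', rfl, -⟩ := hmem p' hp'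
  have hfun : ∀ s ∈ d.D, f (d.L (i 0) s) = d.S (d.L (i 0) s) * f s + q (d.L (i 0) s) := by
    intro s hs
    rw [(hf.maps _ hs).2, hq _ _ hs, F]; ring
  rw [hfun s hsD, hfun s' hsD', Real.dist_eq]
  have h1 := hf.abs_sub_le_osc _ _ hs hs'
  have h2 := hK.dist_le_mul _ hpD _ hpD'
  have h3 := hK'.dist_le_mul _ hpD _ hpD'
  rw [Real.dist_eq] at h2 h3
  have h4 := hB _ hsD'
  rw [Real.norm_eq_abs] at h4
  generalize d.L (i 0) s = p at *
  generalize d.L (i 0) s' = p' at *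
  have e : d.S p * f s + q p - (d.S p' * f s' + q p') =
      d.S p * (f s - f s') + (d.S p - d.S p') * f s' + (q p - q p') := by ring
  rw [e]
  calc |d.S p * (f s - f s') + (d.S p - d.S p') * f s' + (q p - q p')|
      ≤ |d.S p| * |f s - f s'| + |d.S p - d.S p'| * |f s'| + |q p - q p'| := by
        rw [← abs_mul, ← abs_mul]; exact abs_add_three _ _ _
    _ ≤ d.supS (Fin.snoc i a : Word N (k + 2)) *
          d.osc f (Fin.snoc (Fin.tail i) a : Word N (k + 1)) u +
          K * (A / N ^ l) * B + K' * (A / N ^ l) := by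
        gcongr
        · exact h2.trans (by gcongr)
        · exact h3.trans (by gcongr)
    _ = _ := by ring

/-- For `r` above the spectral radius of an upper matrix and above `N`, the total oscillation over
the cells of level `l` grows at most like `r ^ l`. -/
theorem Admissible.exists_sum_osc_le (hd : d.Admissible) (hf : d.IsFIF f) (k : ℕ) {r : ℝ}
    (hr : matrixSpectralRadius (d.upperMatrix k) < r) (hNr : N < r) :
    ∃ K, 0 ≤ K ∧ ∀ l (i : Word N (k + 1)), ∑ u : Word N l, d.osc f i u ≤ K * r ^ l := by
  obtain ⟨c, hc, h⟩ := hd.exists_osc_cons_le hf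
  have hN : (0 : ℝ) < N := by have := hd.two_le; exact_mod_cast (by omega : 0 < N)
  -- There are `N ^ (2 * (l + 1))` words of length `l + 1`, each with error `c / N ^ l`: in total `N
  -- ^ 2 * c * N ^ l`.
  refine exists_le_mul_pow_of_le_mulVec_add (d.upperMatrix k) (upperMatrix_pow_nonneg k)
    (V := fun l i => ∑ u : Word N l, d.osc f i u) (b := N) (c := N ^ 2 * c) hN.le (by positivity)
    (fun l i => ?_) hr hNr
  rw [upperMatrix_mulVec]
  calc ∑ u : Word N (l + 1), d.osc f i u
      ≤ ∑ u : Word N l, ∑ a : Digit N, (d.supS (Fin.snoc i a : Word N (k + 2)) *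
          d.osc f (Fin.snoc (Fin.tail i) a : Word N (k + 1)) u + c / N ^ l) := by
        rw [sum_cons]
        exact Finset.sum_le_sum fun u _ => Finset.sum_le_sum fun a _ => h k l i a u
    _ = (∑ a : Digit N, d.supS (Fin.snoc i a : Word N (k + 2)) *
          ∑ u : Word N l, d.osc f (Fin.snoc (Fin.tail i) a : Word N (k + 1)) u) +
          (N ^ 2) ^ l * N ^ 2 * (c / N ^ l) := by
        simp only [Finset.sum_add_distrib, Finset.mul_sum]
        rw [Finset.sum_comm]
        simp [pow_two]
        ring
    _ = _ := by
        congr 1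
        rw [← pow_mul, mul_comm 2 l, pow_mul]
        field_simp

end FISData

/-! ### Counting cubes -/

theorem card_Icc_ceil_floor_le {s t : ℝ} (h : s ≤ t) :
    ((Finset.Icc ⌈s - 1⌉ ⌊t⌋).card : ℝ) ≤ t - s + 2 := by
  rw [Int.card_Icc]
  have h1 := Int.le_ceil (s - 1)
  have h2 := Int.floor_le t
  have h3 : (((⌊t⌋ + 1 - ⌈s - 1⌉).toNat : ℤ) : ℝ) ≤ t - s + 2 := by
    rw [Int.toNat_eq_max, Int.cast_max]
    push_cast
    exact max_le (by linarith) (by linarith)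
  exact_mod_cast h3

/-- Cover `E` by boxes with centres `c a` and half-widths `δ a`. In direction `k` the indices of
cubes meeting a box lie in an interval of length `2 * (δ a k / ε) + 1`. -/
theorem boxCount_le_sum {d : ℕ} {α : Type*} [Fintype α] {E : Set (Fin d → ℝ)} {ε : ℝ} (hε : 0 < ε)
    (c δ : α → Fin d → ℝ) (hδ : ∀ a k, 0 ≤ δ a k)
    (hE : ∀ p ∈ E, ∃ a, ∀ k, |p k - c a k| ≤ δ a k) :
    (boxCount E ε : ℝ) ≤ ∑ a, ∏ k, (2 * (δ a k / ε) + 2) := by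
  classical
  set T : α → Finset (Fin d → ℤ) := fun a => Fintype.piFinset fun k =>
    Finset.Icc ⌈(c a k - δ a k) / ε - 1⌉ ⌊(c a k + δ a k) / ε⌋ with hT
  have hsub : {n : Fin d → ℤ | (coordCube ε n ∩ E).Nonempty} ⊆ ↑(Finset.univ.biUnion T) := by
    rintro n ⟨p, hp, hpE⟩
    obtain ⟨a, ha⟩ := hE p hpE
    simp only [Finset.coe_biUnion, Set.mem_iUnion, Finset.mem_coe, Finset.mem_univ, exists_prop,
      true_and]
    refine ⟨a, Fintype.mem_piFinset.2 fun k => Finset.mem_Icc.2 ⟨Int.ceil_le.2 ?_, Int.le_floor.2 ?_⟩⟩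
    · rw [sub_le_iff_le_add, div_le_iff₀ hε]
      have := (hp k).2
      have := (abs_le.1 (ha k)).1
      linarith
    · rw [le_div_iff₀ hε]
      have := (hp k).1
      have := (abs_le.1 (ha k)).2
      linarith
  have h1 : boxCount E ε ≤ ∑ a, (T a).card := by
    refine (Set.ncard_le_ncard hsub (Finset.finite_toSet _)).trans ?_
    rw [Set.ncard_coe_finset]
    exact Finset.card_biUnion_le
  calc (boxCount E ε : ℝ) ≤ ∑ a, ((T a).card : ℝ) := by exact_mod_cast h1
    _ ≤ _ := Finset.sum_le_sum fun a _ => by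
      rw [hT, Fintype.card_piFinset, Nat.cast_prod]
      refine Finset.prod_le_prod (fun _ _ => Nat.cast_nonneg _) fun k _ => ?_
      have h2 : (c a k - δ a k) / ε ≤ (c a k + δ a k) / ε := by
        gcongr; linarith [hδ a k]
      refine (card_Icc_ceil_floor_le h2).trans (le_of_eq ?_)
      ring

theorem upperBoxDim_le_of_boxCount_le {d : ℕ} {E : Set (Fin d → ℝ)} {β C ε₀ : ℝ} (hβ : 0 ≤ β)
    (hε₀ : 0 < ε₀) (h : ∀ ε, 0 < ε → ε ≤ ε₀ → (boxCount E ε : ℝ) ≤ C * (1 / ε) ^ β) :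
    upperBoxDim E ≤ (β : EReal) := by
  have hlog : Tendsto (fun ε : ℝ => Real.log (1 / ε)) (𝓝[>] 0) atTop := by
    simp only [one_div]
    exact Real.tendsto_log_atTop.comp tendsto_inv_nhdsGT_zero
  have hlim : Tendsto (fun ε : ℝ => ((Real.log (max C 1) / Real.log (1 / ε) + β : ℝ) : EReal))
      (𝓝[>] 0) (𝓝 (β : EReal)) := by
    refine (continuous_coe_real_ereal.tendsto β).comp ?_
    simpa using (hlog.const_div_atTop (Real.log (max C 1))).add_const β
  rw [← hlim.limsup_eq]
  refine limsup_le_limsup ?_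
  filter_upwards [self_mem_nhdsWithin, mem_nhdsWithin_of_mem_nhds (Iio_mem_nhds hε₀),
    hlog.eventually_gt_atTop 0] with ε hε0 hε1 hl
  have hε : (0 : ℝ) < ε := hε0
  refine EReal.coe_le_coe_iff.2 ?_
  rw [div_add' _ _ _ hl.ne']
  refine div_le_div_of_nonneg_right ?_ hl.le
  -- Replacing `C` by `max C 1` makes its logarithm nonnegative, which covers an empty count, where
  -- `Real.log 0 = 0`.
  have hm : (1 : ℝ) ≤ max C 1 := le_max_right _ _
  have hb : (boxCount E ε : ℝ) ≤ max C 1 * (1 / ε) ^ β :=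
    (h ε hε (le_of_lt hε1)).trans (by gcongr; exact le_max_left _ _)
  rcases Nat.eq_zero_or_pos (boxCount E ε) with h0 | h0
  · rw [h0, Nat.cast_zero, Real.log_zero]
    have := Real.log_nonneg hm
    positivity
  · refine (Real.log_le_log (by exact_mod_cast h0) hb).trans (le_of_eq ?_)
    rw [Real.log_mul (by positivity) (by positivity), Real.log_rpow (by positivity)]

/-! ### Box dimension of the graph -/

namespace FISData

variable {N : ℕ} {d : FISData N} {f : ℝ × ℝ → ℝ}

theorem IsFIF.exists_mem_wordMap_image_cell (hf : d.IsFIF f) (m l : ℕ) {p : ℝ × ℝ}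
    (hp : p ∈ d.D) : ∃ (i : Word N m) (u : Word N l), p ∈ d.wordMap i '' d.cell u := by
  obtain ⟨i, q, hq, rfl⟩ := hf.exists_mem_cell m hp
  obtain ⟨u, hu⟩ := hf.exists_mem_cell l hq
  exact ⟨i, u, q, hu, rfl⟩

/-- Half-widths `ε`, `ε`, `osc` give the factors `4`, `4` and `2 * (osc / ε + 1)`, hence the
constant `32`. -/
theorem IsFIF.boxCount_graph_le (hd : d.Admissible) (hf : d.IsFIF f) {m l : ℕ} {A ε : ℝ}
    (hε : 0 < ε) (hA : ∀ (i : Word N m) (u : Word N l), ∀ p ∈ d.wordMap i '' d.cell u,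
      ∀ q ∈ d.wordMap i '' d.cell u, dist p q ≤ A) (hAε : A ≤ ε) :
    (boxCount (d.graph f) ε : ℝ) ≤
      ∑ i : Word N m, ∑ u : Word N l, 32 * (d.osc f i u / ε + 1) := by
  have hne : ∀ (i : Word N m) (u : Word N l), ∃ p, p ∈ d.wordMap i '' d.cell u := fun i u =>
    (hd.nonempty_D.image _).image _
  choose c hc using hne
  have hosc : ∀ (i : Word N m) (u : Word N l), 0 ≤ d.osc f i u := fun _ _ => Metric.diam_nonneg
  rw [← Fintype.sum_prod_type' (f := fun (i : Word N m) (u : Word N l) =>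
    32 * (d.osc f i u / ε + 1))]
  refine (boxCount_le_sum hε
    (fun a : Word N m × Word N l => ![(c a.1 a.2).1, (c a.1 a.2).2, f (c a.1 a.2)])
    (fun a => ![ε, ε, d.osc f a.1 a.2]) ?_ ?_).trans (le_of_eq ?_)
  · intro a k
    fin_cases k
    · exact hε.le
    · exact hε.le
    · exact hosc _ _
  · rintro _ ⟨p, hp, rfl⟩
    obtain ⟨i, u, hiu⟩ := hf.exists_mem_wordMap_image_cell m l hp
    have h := (hA i u p hiu _ (hc i u)).trans hAε
    rw [Prod.dist_eq, max_le_iff, Real.dist_eq, Real.dist_eq] at h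
    refine ⟨(i, u), fun k => ?_⟩
    fin_cases k
    · exact h.1
    · exact h.2
    · exact hf.abs_sub_le_osc i u hiu (hc i u)
  · refine Finset.sum_congr rfl fun a _ => ?_
    rw [Fin.prod_univ_three]
    simp only [Matrix.cons_val]
    rw [div_self hε.ne']
    ring

theorem Admissible.upperBoxDim_graph_le (hd : d.Admissible) (hf : d.IsFIF f) (k : ℕ) {r : ℝ}
    (hr : matrixSpectralRadius (d.upperMatrix k) < r) (hNr : N < r) :
    upperBoxDim (d.graph f) ≤ ((1 + Real.log r / Real.log N : ℝ) : EReal) := by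
  obtain ⟨K, hK, hsum⟩ := hd.exists_sum_osc_le hf k hr hNr
  obtain ⟨A, hA, hdist⟩ := hd.exists_dist_le
  have hN : (1 : ℝ) < N := by have := hd.two_le; exact_mod_cast (by omega : 1 < N)
  have hN0 : (0 : ℝ) < N := by linarith
  have hr0 : 0 < r := by linarith
  have hlogN : 0 < Real.log N := Real.log_pos hN
  have hlogr : 0 < Real.log r := Real.log_pos (by linarith)
  set β : ℝ := 1 + Real.log r / Real.log N with hβ
  have hβ0 : 0 ≤ β := by positivity
  have hNβ : (N : ℝ) ^ β = N * r := by
    rw [hβ, Real.rpow_add hN0, Real.rpow_one, Real.rpow_def_of_pos hN0, mul_div_cancel₀ _ hlogN.ne',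
      Real.exp_log hr0]
  set W : ℝ := (Fintype.card (Word N (k + 1)) : ℝ) with hW
  have hW0 : 0 ≤ W := Nat.cast_nonneg _
  refine upperBoxDim_le_of_boxCount_le (C := 32 * W * (K * N / A + 1) * A ^ β) hβ0 hA
    fun ε hε hεA => ?_
  -- Here `N ^ l ≤ A / ε < N ^ (l + 1)`. Cells of level `k + 1 + l` then have diameter at most `ε`,
  -- because the prefix contributes at least one letter.
  obtain ⟨l, hl1, hl2⟩ := exists_nat_pow_near ((one_le_div hε).2 hεA) hN
  have hAε : A / N ^ (k + 1 + l) ≤ ε := by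
    rw [div_le_iff₀ (by positivity)]
    rw [div_lt_iff₀ hε] at hl2
    refine hl2.le.trans ?_
    rw [mul_comm]
    exact mul_le_mul_of_nonneg_left (pow_le_pow_right₀ hN.le (by omega)) hε.le
  have hε' : 1 / ε ≤ N * N ^ l / A := by
    rw [div_lt_iff₀ hε, pow_succ] at hl2
    rw [div_le_div_iff₀ hε hA]
    linarith
  have hbox := hf.boxCount_graph_le hd hε (hdist (m := k + 1) (l := l)) hAε
  have hNl : (N : ℝ) ^ l * r ^ l ≤ (A / ε) ^ β := by
    rw [← mul_pow, ← hNβ, ← Real.rpow_natCast, ← Real.rpow_mul hN0.le, mul_comm,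
      Real.rpow_mul hN0.le, Real.rpow_natCast]
    exact Real.rpow_le_rpow (by positivity) hl1 hβ0
  calc (boxCount (d.graph f) ε : ℝ)
      ≤ ∑ i : Word N (k + 1), ∑ u : Word N l, 32 * (d.osc f i u / ε + 1) := hbox
    _ = ∑ i : Word N (k + 1), 32 * ((∑ u : Word N l, d.osc f i u) * (1 / ε) + N ^ l * N ^ l) := by
        refine Finset.sum_congr rfl fun i _ => ?_
        rw [← Finset.mul_sum, Finset.sum_add_distrib, ← Finset.sum_div]
        simp [mul_pow, div_eq_mul_inv]
    -- The count of cells is absorbed using `N < r`.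
    _ ≤ ∑ _i : Word N (k + 1), 32 * (K * r ^ l * (N * N ^ l / A) + N ^ l * r ^ l) := by
        refine Finset.sum_le_sum fun i _ => ?_
        gcongr
        exact hsum l i
    _ = 32 * W * (K * N / A + 1) * (N ^ l * r ^ l) := by
        rw [Finset.sum_const, nsmul_eq_mul, Finset.card_univ, ← hW]
        ring
    _ ≤ 32 * W * (K * N / A + 1) * (A / ε) ^ β := by gcongr
    _ = _ := by
        rw [div_eq_mul_one_div A ε, Real.mul_rpow hA.le (by positivity)]
        ring

end FISData

/-! ### Passage to the limit in the level -/

theorem mainTheorem2 {N : ℕ} (d : FISData N) (hd : d.Admissible)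
    (hS : d.NonvanishingOnRectangles) (f : ℝ × ℝ → ℝ) (hf : d.IsFIF f) :
    ∃ ρ : ℝ, Tendsto (fun n => matrixSpectralRadius (d.upperMatrix n)) atTop (𝓝 ρ) ∧
      upperBoxDim (d.graph f) ≤ ((max 2 (1 + Real.log ρ / Real.log N) : ℝ) : EReal) := by
  have hlim := tendsto_atTop_ciInf (hd.matrixSpectralRadius_upperMatrix_antitone hf)
    ⟨0, by rintro _ ⟨n, rfl⟩; exact matrixSpectralRadius_nonneg _⟩
  generalize (⨅ n, matrixSpectralRadius (d.upperMatrix n)) = ρ at hlim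
  refine ⟨ρ, hlim, ?_⟩
  have hN : (1 : ℝ) < N := by have := hd.two_le; exact_mod_cast (by omega : 1 < N)
  have hm : 0 < max ρ N := (zero_lt_one.trans hN).trans_le (le_max_right _ _)
  have hle : upperBoxDim (d.graph f) ≤
      ((1 + Real.log (max ρ N) / Real.log N : ℝ) : EReal) := by
    have ht : Tendsto (fun r : ℝ => ((1 + Real.log r / Real.log N : ℝ) : EReal))
        (𝓝[>] (max ρ N)) (𝓝 ((1 + Real.log (max ρ N) / Real.log N : ℝ) : EReal)) :=
      (continuous_coe_real_ereal.tendsto _).comp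
        ((((Real.continuousAt_log hm.ne').tendsto.div_const _).const_add 1).mono_left
          nhdsWithin_le_nhds)
    refine ge_of_tendsto ht ?_
    filter_upwards [self_mem_nhdsWithin] with r hr
    obtain ⟨k, hk⟩ := (hlim.eventually_lt_const ((le_max_left ρ N).trans_lt hr)).exists
    exact hd.upperBoxDim_graph_le hf k hk ((le_max_right ρ N).trans_lt hr)
  refine hle.trans (EReal.coe_le_coe_iff.2 ?_)
  -- The case `ρ ≤ N` includes `ρ = 0`, where `Real.log 0 = 0` makes the stated maximum equal to
  -- `2`, as it should be.
  rcases le_total ρ N with h | h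
  · rw [max_eq_right h, div_self (Real.log_pos hN).ne']
    exact (by norm_num : (1 : ℝ) + 1 ≤ 2).trans (le_max_left _ _)
  · rw [max_eq_left h]
    exact le_max_right _ _
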